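/- Consider the sparse sequence model $X_i=\theta_i+\varepsilon_i$, $i=1,\dots,n$, with $\varepsilon_i$ i.i.d. $\mathcal N(0,1)$ and $\theta\in\mathbb R^n$; write $P_\theta,E_\theta$ for the law of $X=(X_1,\dots,X_n)$ and the corresponding expectation. A procedure is a measurable map $\varphi=(\varphi_i(X))_{1\le i\le n}$ with values in $\{0,1\}^n$. Put $$N_{FP}(\theta,\varphi)=\sum_{i=1}^n 1\{\theta_i=0,\varphi_i=1\},\qquad N_{FN}(\theta,\varphi)=\sum_{i=1}^n 1\{\theta_i\neq0,\varphi_i=0\},$$ $$\mathrm{FDR}(\theta,\varphi)=E_\theta\Big[\frac{N_{FP}(\theta,\varphi)}{1\vee\sum_i 1\{\varphi_i=1\}}\Big],\qquad \mathrm{FNR}(\theta,\varphi)=E_\theta\Big[\frac{N_{FN}(\theta,\varphi)}{1\vee\sum_i 1\{\theta_i\ne0\}}\Big],$$ $$\mathfrak R(\theta,\varphi)=\mathrm{FDR}(\theta,\varphi)+\mathrm{FNR}(\theta,\varphi),\qquad R_C(\theta,\varphi)=E_\theta N_{FP}(\theta,\varphi)+E_\theta N_{FN}(\theta,\varphi).$$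 For $b\in[-\infty,+\infty]$, let $\mathcal L_0[s_n;b]$ be the set of all $\theta\in\mathbb R^n$ that have exactly $s_n$ nonzero coordinates, each of which satisfies $|\theta_i|\ge\sqrt{2\log(n/s_n)}+b$. Let $\bar\Phi(b)=P(\mathcal N(0,1)>b)$, so that $\bar\Phi(-\infty)=1$ and $\bar\Phi(+\infty)=0$. **Theorem.** Let $(s_n)$ be a sequence of nonnegative integers such that $s_n\to\infty$ and $n/s_n\to\infty$ as $n\to\infty$. Then, for every $b\in[-\infty,+\infty]$, possibly depending on $n$, $$\rho_b:=\inf_\varphi\ \sup_{\theta\in\mathcal L_0[s_n;b]}\mathfrak R(\theta,\varphi)=\bar\Phi(b)+o(1)\qquad(n\to\infty),$$ where the infimum is over all procedures and a supremum over the empty set is $0$. In particular: (i) if $b=b_n\in\mathbb R$ and $b_n\to-\infty$, then $\rho_b\to1$; (ii) if $b\in\mathbb R$ is fixed, then $\rho_b\to\bar\Phi(b)$; (iii) if $b=b_n\in\mathbb R$ and $b_n\to+\infty$, then $\rho_b\to0$. The same statements, the display and (i)--(iii), hold with $\mathfrak R(\theta,\varphi)$ replaced by the normalised classification risk $R_C(\theta,\varphi)/s_n$.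 -/

import Mathlib

open MeasureTheory ProbabilityTheory Filter Topology

namespace SparseTesting

noncomputable section

/-- Law `P_θ` of `X = θ + ε` in `ℝⁿ`, with `ε` a vector of iid standard Gaussian variables:
the product of the laws `N(θ_i, 1)`. -/
def sequenceLaw {n : ℕ} (θ : Fin n → ℝ) : Measure (Fin n → ℝ) :=
  Measure.pi fun i => gaussianReal (θ i) 1

/-- Multiple testing (or classification) procedures: measurable maps `ℝⁿ → {0,1}ⁿ`;
`φ X i = true` means that the null hypothesis `θ_i = 0` is rejected. -/
def Procedure (n : ℕ) : Type :=
  {φ : (Fin n → ℝ) → (Fin n → Bool) // Measurable φ}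

/-- Number of false positives, for the decision vector `d` at `θ`. -/
def numFP {n : ℕ} (θ : Fin n → ℝ) (d : Fin n → Bool) : ℕ :=
  (Finset.univ.filter fun i => θ i = 0 ∧ d i = true).card

/-- Number of false negatives, for the decision vector `d` at `θ`. -/
def numFN {n : ℕ} (θ : Fin n → ℝ) (d : Fin n → Bool) : ℕ :=
  (Finset.univ.filter fun i => θ i ≠ 0 ∧ d i = false).card

/-- Number of discoveries of the decision vector `d`. -/
def numDisc {n : ℕ} (d : Fin n → Bool) : ℕ :=
  (Finset.univ.filter fun i => d i = true).card

/-- Number of nonzero coordinates of `θ`. -/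
def numNonzero {n : ℕ} (θ : Fin n → ℝ) : ℕ :=
  (Finset.univ.filter fun i => θ i ≠ 0).card

/-- False discovery rate `E_θ[N_FP / (1 ∨ #discoveries)]`. -/
def FDR {n : ℕ} (θ : Fin n → ℝ) (φ : Procedure n) : ℝ :=
  ∫ X, (numFP θ (φ.1 X) : ℝ) / max 1 (numDisc (φ.1 X) : ℝ) ∂(sequenceLaw θ)

/-- False negative rate `E_θ[N_FN / (1 ∨ #nonzeros)]`. -/
def FNR {n : ℕ} (θ : Fin n → ℝ) (φ : Procedure n) : ℝ :=
  ∫ X, (numFN θ (φ.1 X) : ℝ) / max 1 (numNonzero θ : ℝ) ∂(sequenceLaw θ)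

/-- Multiple testing risk. -/
def testingRisk {n : ℕ} (θ : Fin n → ℝ) (φ : Procedure n) : ℝ :=
  FDR θ φ + FNR θ φ

/-- Classification risk `E_θ N_FP + E_θ N_FN`. -/
def classificationRisk {n : ℕ} (θ : Fin n → ℝ) (φ : Procedure n) : ℝ :=
  (∫ X, (numFP θ (φ.1 X) : ℝ) ∂(sequenceLaw θ)) + ∫ X, (numFN θ (φ.1 X) : ℝ) ∂(sequenceLaw θ)

/-- Nearly black vectors: at most `s` nonzero coordinates. -/
def nearlyBlack (n s : ℕ) : Set (Fin n → ℝ) :=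
  {θ | numNonzero θ ≤ s}

/-- Vectors with exactly `s` nonzero coordinates, each of absolute value at least
`√(2 log (n / s)) + b`. For `b = -∞` the lower bound on the coordinates is void. -/
def signalClass (n s : ℕ) (b : EReal) : Set (Fin n → ℝ) :=
  {θ | θ ∈ nearlyBlack n s ∧ numNonzero θ = s ∧
    ∀ i, θ i ≠ 0 → ((Real.sqrt (2 * Real.log ((n : ℝ) / s)) : ℝ) : EReal) + b ≤ (|θ i| : ℝ)}

/-- Minimax risk `inf_φ sup_{θ ∈ Θ} R(θ, φ)`, the infimum being over all procedures. The risks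
used here take values in a bounded interval of nonnegative numbers (for fixed `n`), so that these
are genuine infima and suprema; a supremum over an empty class is `0`. -/
def minimaxRisk {n : ℕ} (R : (Fin n → ℝ) → Procedure n → ℝ) (Θ : Set (Fin n → ℝ)) : ℝ :=
  ⨅ φ : Procedure n, ⨆ θ : Θ, R θ φ

/-- Minimax multiple testing risk over the signal class. -/
def minimaxTesting (n s : ℕ) (b : EReal) : ℝ :=
  minimaxRisk testingRisk (signalClass n s b)

/-- Minimax classification risk, normalised by the number `s` of signals, over the signal class. -/
def minimaxClassification (n s : ℕ) (b : EReal) : ℝ :=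
  minimaxRisk (fun θ φ => classificationRisk θ φ / s) (signalClass n s b)

/-- Standard Gaussian upper tail `P(Z > b)`, for `b ∈ [-∞, +∞]`. -/
def gaussianTail (b : EReal) : ℝ :=
  (gaussianReal 0 1).real {x : ℝ | b < (x : EReal)}

end

end SparseTesting

namespace SparseTesting

/-! ### Gaussian tails -/

/-! Write `t = √(2 log(n/s))`. Since `exp(-t²/2) = s/n`, the level `t + δ` is exceeded by only
`o(s)` null observations on average, while about `n · P(Z > t - δ)`, which is much more than `s`,
exceed `t - δ`. The detection boundary is thus sharp at `t`, and a signal of size `t + b` is lost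
with probability close to `P(Z > b)`.

Upper bound: threshold `|X_i|` at `t + δ` (`minimaxClassification_le`, `minimaxTesting_le`). For the
FDR, Chebyshev's inequality gives a number of true discoveries of order `s`, which controls the
random denominator. When `b` is very negative, rejecting nothing already has risk at most 1.

Lower bound: put spikes of height `a = t + b'` at permuted positions. If a procedure rejects a
signal whose observation lies below that of some null, exchanging the two means makes the same event
at least as likely and turns the rejection into a false positive. Averaging over permutations, a
signal exceeded by at least `s/w` nulls costs about one unit of risk, missed or not
(`card_mul_le_of_weightedRisk_le`). Such a signal occurs when its observation is below `t - δ`, up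
to a Chebyshev error (`le_of_weightedRisk_le`). The case `w = 1` is classification; FDR + FNR is
reduced to a small `w` by truncating procedures with too many discoveries (`truncate_loss_le`).

All errors are uniform in `b`, since the Gaussian tail is Lipschitz and `b` may be clipped at a
large negative constant. -/

lemma gaussianTail_coe (b : ℝ) :
    gaussianTail (b : EReal) = (gaussianReal 0 1).real (Set.Ioi b) := by
  unfold gaussianTail
  congr 1
  ext x
  simp

lemma gaussianTail_bot : gaussianTail ⊥ = 1 := by
  simp [gaussianTail]

lemma gaussianTail_top : gaussianTail ⊤ = 0 := by
  simp [gaussianTail]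

lemma gaussianTail_nonneg (b : EReal) : 0 ≤ gaussianTail b := measureReal_nonneg

lemma gaussianTail_le_one (b : EReal) : gaussianTail b ≤ 1 := measureReal_le_one

lemma gaussianTail_antitone : Antitone gaussianTail := fun _ _ h =>
  measureReal_mono fun _ hx => lt_of_le_of_lt h hx

lemma gaussianReal_real_Ioi (m x : ℝ) :
    (gaussianReal m 1).real (Set.Ioi x) = gaussianTail ((x - m : ℝ) : EReal) := by
  rw [gaussianTail_coe]
  have h := gaussianReal_map_add_const (μ := 0) (v := 1) m
  rw [zero_add] at h
  rw [← h, map_measureReal_apply (by fun_prop) measurableSet_Ioi]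
  congr 1
  ext y
  simp [sub_lt_iff_lt_add]

lemma gaussianReal_real_Iio (m x : ℝ) :
    (gaussianReal m 1).real (Set.Iio x) = gaussianTail ((m - x : ℝ) : EReal) := by
  have h := gaussianReal_map_neg (μ := -m) (v := 1)
  rw [neg_neg] at h
  rw [← h, map_measureReal_apply (by fun_prop) measurableSet_Iio]
  have : (fun x : ℝ => -x) ⁻¹' Set.Iio x = Set.Ioi (-x) := by
    ext y; simp
  rw [this, gaussianReal_real_Ioi]
  congr 2
  ring

lemma gaussianReal_real_Ici (m x : ℝ) :
    (gaussianReal m 1).real (Set.Ici x) = gaussianTail ((x - m : ℝ) : EReal) := by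
  have := nullSingletonClass_gaussianReal (μ := m) (v := 1) one_ne_zero
  rw [← gaussianReal_real_Ioi]
  exact measureReal_congr Ioi_ae_eq_Ici.symm

lemma gaussianTail_neg (b : ℝ) :
    gaussianTail ((-b : ℝ) : EReal) = 1 - gaussianTail (b : EReal) := by
  have h1 := gaussianReal_real_Iio 0 b
  have h2 := gaussianReal_real_Ici 0 b
  rw [zero_sub] at h1
  rw [sub_zero] at h2
  rw [← h1, ← h2, ← Set.compl_Ici, measureReal_compl measurableSet_Ici]
  simp

lemma gaussianPDFReal_zero_one (x : ℝ) :
    gaussianPDFReal 0 1 x = (√(2 * Real.pi))⁻¹ * Real.exp (-x ^ 2 / 2) := by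
  simp [gaussianPDFReal]

lemma inv_sqrt_two_pi_bounds : 1 / 3 ≤ (√(2 * Real.pi))⁻¹ ∧ (√(2 * Real.pi))⁻¹ ≤ 1 := by
  have h1 : √(2 * Real.pi) ≤ 3 := by
    rw [Real.sqrt_le_left (by norm_num)]
    linarith [Real.pi_lt_four]
  have h2 : 1 ≤ √(2 * Real.pi) := by
    rw [Real.one_le_sqrt]
    linarith [Real.pi_gt_three]
  constructor
  · rw [one_div]
    exact inv_anti₀ (by linarith) h1
  · exact inv_le_one_of_one_le₀ h2

lemma gaussianReal_real_Ioc (x y : ℝ) (h : x ≤ y) :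
    (gaussianReal 0 1).real (Set.Ioc x y) = gaussianTail (x : EReal) - gaussianTail (y : EReal) := by
  rw [gaussianTail_coe, gaussianTail_coe, ← Set.Ioi_sdiff_Ioi, measureReal_sdiff
    (Set.Ioi_subset_Ioi h) measurableSet_Ioi]

lemma gaussianReal_real_Ioc_eq_integral (x y : ℝ) :
    (gaussianReal 0 1).real (Set.Ioc x y) = ∫ z in Set.Ioc x y, gaussianPDFReal 0 1 z := by
  rw [measureReal_def, gaussianReal_apply_eq_integral _ one_ne_zero, ENNReal.toReal_ofReal]
  exact integral_nonneg fun z => gaussianPDFReal_nonneg _ _ _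

/-- The Gaussian density is at most 1, so the tail is 1-Lipschitz. This makes every shift by `δ`
cost at most `δ`, uniformly in `b`. -/
lemma gaussianTail_sub_le (b δ : ℝ) (hδ : 0 ≤ δ) :
    gaussianTail (b : EReal) - δ ≤ gaussianTail ((b + δ : ℝ) : EReal) := by
  have h := gaussianReal_real_Ioc b (b + δ) (by linarith)
  rw [gaussianReal_real_Ioc_eq_integral] at h
  have : ∫ z in Set.Ioc b (b + δ), gaussianPDFReal 0 1 z ≤ ∫ z in Set.Ioc b (b + δ), (1 : ℝ) := by
    refine setIntegral_mono (integrable_gaussianPDFReal _ _).integrableOn (by simp) fun z => ?_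
    rw [gaussianPDFReal_zero_one]
    exact mul_le_one₀ inv_sqrt_two_pi_bounds.2 (by positivity)
      (Real.exp_le_one_iff.2 (by nlinarith [sq_nonneg z]))
  simp only [integral_const, MeasurableSet.univ, measureReal_restrict_apply, Set.univ_inter,
    Real.volume_real_Ioc, smul_eq_mul, mul_one, add_sub_cancel_left, max_eq_left hδ] at this
  linarith

/-- The density on `(x, x + δ]` is at least its value at `x + δ`. This crude substitute for Mills'
ratio suffices because later arguments have a factor `exp(ct)` to spare. -/
lemma le_gaussianTail (x δ : ℝ) (hx : 0 ≤ x) (hδ : 0 ≤ δ) :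
    δ / 3 * Real.exp (-(x + δ) ^ 2 / 2) ≤ gaussianTail (x : EReal) := by
  have h := gaussianReal_real_Ioc x (x + δ) (by linarith)
  rw [gaussianReal_real_Ioc_eq_integral] at h
  have : ∫ z in Set.Ioc x (x + δ), (1 / 3 * Real.exp (-(x + δ) ^ 2 / 2))
      ≤ ∫ z in Set.Ioc x (x + δ), gaussianPDFReal 0 1 z := by
    refine setIntegral_mono_on (integrableOn_const (by simp)) (integrable_gaussianPDFReal _ _).integrableOn
      measurableSet_Ioc fun z hz => ?_
    rw [gaussianPDFReal_zero_one]
    refine mul_le_mul inv_sqrt_two_pi_bounds.1 ?_ (by positivity) (by positivity)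
    rw [Real.exp_le_exp]
    have : z ^ 2 ≤ (x + δ) ^ 2 := pow_le_pow_left₀ (hx.trans hz.1.le) hz.2 2
    linarith
  simp only [integral_const, MeasurableSet.univ, measureReal_restrict_apply, Set.univ_inter,
    Real.volume_real_Ioc, smul_eq_mul, add_sub_cancel_left, max_eq_left hδ] at this
  linarith [gaussianTail_nonneg ((x + δ : ℝ) : EReal)]

/-- Chernoff's bound at the optimal parameter `x`. -/
lemma gaussianTail_le_exp (x : ℝ) (hx : 0 ≤ x) :
    gaussianTail (x : EReal) ≤ Real.exp (-x ^ 2 / 2) := by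
  have h := measure_ge_le_exp_mul_mgf (μ := gaussianReal 0 1) (X := id) x hx
    (by simpa using integrable_exp_mul_gaussianReal (μ := 0) (v := 1) x)
  rw [mgf_id_gaussianReal, ← Real.exp_add] at h
  have e : {ω : ℝ | x ≤ id ω} = Set.Ici x := rfl
  rw [e, gaussianReal_real_Ici, sub_zero] at h
  refine h.trans (Real.exp_le_exp.2 (le_of_eq ?_))
  simp
  ring

lemma gaussianTail_pos (x : ℝ) : 0 < gaussianTail (x : EReal) := by
  have h := le_gaussianTail (max x 0) 1 (le_max_right _ _) zero_le_one
  have h2 : gaussianTail ((max x 0 : ℝ) : EReal) ≤ gaussianTail (x : EReal) :=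
    gaussianTail_antitone (EReal.coe_le_coe_iff.2 (le_max_left _ _))
  exact lt_of_lt_of_le (by positivity) (h.trans h2)

lemma tendsto_gaussianTail_atTop :
    Tendsto (fun x : ℝ => gaussianTail (x : EReal)) atTop (𝓝 0) := by
  have h : Tendsto (fun x : ℝ => Real.exp (-x ^ 2 / 2)) atTop (𝓝 0) := by
    refine Real.tendsto_exp_atBot.comp ?_
    have h2 : Tendsto (fun x : ℝ => x ^ 2 / 2) atTop atTop :=
      (tendsto_pow_atTop two_ne_zero).atTop_div_const two_pos
    refine (tendsto_neg_atTop_atBot.comp h2).congr fun x => ?_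
    simp [neg_div]
  refine squeeze_zero' (Eventually.of_forall fun x => gaussianTail_nonneg _) ?_ h
  filter_upwards [eventually_ge_atTop 0] with x hx using gaussianTail_le_exp x hx

lemma tendsto_gaussianTail_atBot :
    Tendsto (fun x : ℝ => gaussianTail (x : EReal)) atBot (𝓝 1) := by
  have h := (tendsto_gaussianTail_atTop.comp tendsto_neg_atBot_atTop).const_sub 1
  rw [sub_zero] at h
  refine h.congr fun x => ?_
  simp only [Function.comp]
  rw [gaussianTail_neg, sub_sub_cancel]

lemma gaussianReal_zero_real_abs_ge (τ : ℝ) :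
    (gaussianReal 0 1).real {x | τ ≤ |x|} ≤ 2 * gaussianTail (τ : EReal) := by
  have h : {x : ℝ | τ ≤ |x|} = Set.Ici τ ∪ Set.Iic (-τ) := by
    ext x
    simp [le_abs, le_neg]
  rw [h, two_mul]
  refine (measureReal_union_le _ _).trans (add_le_add ?_ ?_)
  · rw [gaussianReal_real_Ici, sub_zero]
  · have := nullSingletonClass_gaussianReal (μ := 0) (v := 1) one_ne_zero
    rw [← measureReal_congr (Iio_ae_eq_Iic (μ := gaussianReal 0 1) (a := -τ)),
      gaussianReal_real_Iio, zero_sub, neg_neg]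

lemma gaussianReal_real_abs_lt (m τ : ℝ) :
    (gaussianReal m 1).real {x | |x| < τ} ≤ gaussianTail ((|m| - τ : ℝ) : EReal) := by
  rcases abs_cases m with ⟨h, -⟩ | ⟨h, -⟩ <;> rw [h]
  · rw [← gaussianReal_real_Iio]
    exact measureReal_mono fun x (hx : |x| < τ) => (abs_lt.1 hx).2
  · have : -m - τ = -τ - m := by ring
    rw [this, ← gaussianReal_real_Ioi]
    exact measureReal_mono fun x (hx : |x| < τ) => (abs_lt.1 hx).1

/-! ### The law of the observations -/

instance {n : ℕ} (θ : Fin n → ℝ) : IsProbabilityMeasure (sequenceLaw θ) := by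
  unfold sequenceLaw; infer_instance

lemma sequenceLaw_real_eval {n : ℕ} (θ : Fin n → ℝ) (i : Fin n) {A : Set ℝ}
    (hA : MeasurableSet A) :
    (sequenceLaw θ).real {X | X i ∈ A} = (gaussianReal (θ i) 1).real A :=
  (measurePreserving_eval (fun i => gaussianReal (θ i) 1) i).measureReal_preimage
    hA.nullMeasurableSet

/-- A function of the decisions factors through the finite space of decision vectors. -/
lemma Procedure.integrable {n : ℕ} (φ : Procedure n) (g : (Fin n → Bool) → ℝ)
    (μ : Measure (Fin n → ℝ)) [IsFiniteMeasure μ] : Integrable (fun X => g (φ.1 X)) μ :=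
  (Integrable.of_finite (μ := μ.map φ.1) (f := g)).comp_measurable φ.2

lemma Procedure.measurableSet {n : ℕ} (φ : Procedure n) (S : Set (Fin n → Bool)) :
    MeasurableSet {X | φ.1 X ∈ S} :=
  φ.2 S.toFinite.measurableSet

lemma Procedure.integral_card {n : ℕ} (φ : Procedure n) (J : Finset (Fin n)) (b : Bool)
    (μ : Measure (Fin n → ℝ)) [IsFiniteMeasure μ] :
    ∫ X, ((J.filter fun i => φ.1 X i = b).card : ℝ) ∂μ = ∑ i ∈ J, μ.real {X | φ.1 X i = b} := by
  have h : ∀ X, ((J.filter fun i => φ.1 X i = b).card : ℝ)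
      = ∑ i ∈ J, {X | φ.1 X i = b}.indicator (fun _ => (1 : ℝ)) X := by
    intro X
    simp [Set.indicator_apply, Finset.sum_boole]
  simp_rw [h]
  have hm : ∀ i, MeasurableSet {X | φ.1 X i = b} := fun i => φ.measurableSet {d | d i = b}
  rw [integral_finsetSum _ fun i _ => (integrable_const 1).indicator (hm i)]
  exact Finset.sum_congr rfl fun i _ => integral_indicator_one (hm i)

lemma integral_numFP {n : ℕ} (θ : Fin n → ℝ) (φ : Procedure n)
    (μ : Measure (Fin n → ℝ)) [IsFiniteMeasure μ] :
    ∫ X, (numFP θ (φ.1 X) : ℝ) ∂μ = ∑ i with θ i = 0, μ.real {X | φ.1 X i = true} := by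
  rw [← φ.integral_card]
  simp [numFP, Finset.filter_filter]

lemma integral_numFN {n : ℕ} (θ : Fin n → ℝ) (φ : Procedure n)
    (μ : Measure (Fin n → ℝ)) [IsFiniteMeasure μ] :
    ∫ X, (numFN θ (φ.1 X) : ℝ) ∂μ = ∑ i with θ i ≠ 0, μ.real {X | φ.1 X i = false} := by
  rw [← φ.integral_card]
  simp [numFN, Finset.filter_filter]

open scoped Classical in
/-- Chebyshev's inequality for the number of independent events that occur. -/
lemma pi_real_card_le {ι : Type*} [Fintype ι] (μ : ι → Measure ℝ)
    [∀ i, IsProbabilityMeasure (μ i)] (J : Finset ι) {A : ι → Set ℝ}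
    (hA : ∀ i, MeasurableSet (A i)) {m : ℝ} (hm : 0 < m) (hmJ : m ≤ ∑ i ∈ J, (μ i).real (A i)) :
    (Measure.pi μ).real {x | ((J.filter fun i => x i ∈ A i).card : ℝ) ≤ m / 2} ≤ 4 / m := by
  set M := ∑ i ∈ J, (μ i).real (A i) with hM
  let Y : ι → (ι → ℝ) → ℝ := fun i x => (A i).indicator (fun _ => (1 : ℝ)) (x i)
  have hmA : ∀ i, MeasurableSet ((fun x : ι → ℝ => x i) ⁻¹' A i) :=
    fun i => measurable_pi_apply i (hA i)
  have hYe : ∀ i, Y i = ((fun x : ι → ℝ => x i) ⁻¹' A i).indicator (1 : (ι → ℝ) → ℝ) := by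
    intro i; ext x; simp [Y, Set.indicator_apply]
  have hY2 : ∀ i, MemLp (Y i) 2 (Measure.pi μ) := fun i => by
    rw [hYe]
    exact (memLp_const (1 : ℝ)).indicator (hmA i)
  have hYint : ∀ i, (Measure.pi μ)[Y i] = (μ i).real (A i) := fun i => by
    rw [hYe, integral_indicator_one (hmA i)]
    exact (measurePreserving_eval μ i).measureReal_preimage (hA i).nullMeasurableSet
  have hind : iIndepFun Y (Measure.pi μ) :=
    iIndepFun_pi (X := fun i y => (A i).indicator (fun _ => (1 : ℝ)) y)
      fun i => (measurable_const.indicator (hA i)).aemeasurable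
  -- An indicator equals its square, so its variance is at most its mean.
  have hvar : variance (∑ i ∈ J, Y i) (Measure.pi μ) ≤ M := by
    rw [IndepFun.variance_sum (fun i _ => hY2 i) (fun i _ j _ hij => hind.indepFun hij)]
    refine Finset.sum_le_sum fun i _ => ?_
    refine (variance_le_expectation_sq (hY2 i).1).trans (le_of_eq ?_)
    rw [← hYint i]
    congr 1
    ext x
    by_cases h : x i ∈ A i <;> simp [Y, h]
  have hexp : (Measure.pi μ)[∑ i ∈ J, Y i] = M := by
    simp_rw [Finset.sum_apply]
    rw [integral_finsetSum _ fun i _ => (hY2 i).integrable (by norm_num)]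
    exact Finset.sum_congr rfl fun i _ => hYint i
  have hMpos : 0 < M := hm.trans_le hmJ
  have hch := meas_ge_le_variance_div_sq (memLp_finsetSum' J fun i _ => hY2 i) (half_pos hMpos)
  rw [hexp] at hch
  have hle : (Measure.pi μ).real {x | ((J.filter fun i => x i ∈ A i).card : ℝ) ≤ m / 2}
      ≤ variance (∑ i ∈ J, Y i) (Measure.pi μ) / (M / 2) ^ 2 := by
    -- As `m ≤ M`, a count of at most `m / 2` deviates from its mean `M` by at least `M / 2`.
    refine (measureReal_mono (fun x hx => ?_)).trans
      (ENNReal.toReal_le_of_le_ofReal (div_nonneg (variance_nonneg _ _) (sq_nonneg _)) hch)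
    have e : (∑ i ∈ J, Y i) x = ((J.filter fun i => x i ∈ A i).card : ℝ) := by
      simp [Y, Set.indicator_apply, Finset.sum_boole]
    simp only [Set.mem_ofPred_eq] at hx ⊢
    rw [e, le_abs]
    right
    linarith
  refine hle.trans ?_
  calc variance (∑ i ∈ J, Y i) (Measure.pi μ) / (M / 2) ^ 2 ≤ M / (M / 2) ^ 2 := by gcongr
    _ = 4 / M := by field_simp; norm_num
    _ ≤ 4 / m := by gcongr

/-! ### Product densities and exchange of two means -/

lemma pi_withDensity_ofReal {ι : Type*} [Fintype ι] (f : ι → ℝ → ℝ) (hf : ∀ i x, 0 ≤ f i x)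
    (hi : ∀ i, Integrable (f i)) :
    Measure.pi (fun i => volume.withDensity fun x => ENNReal.ofReal (f i x))
      = volume.withDensity fun x : ι → ℝ => ENNReal.ofReal (∏ i, f i (x i)) := by
  have hfin : ∀ i, IsFiniteMeasure (volume.withDensity fun x => ENNReal.ofReal (f i x)) :=
    fun i => isFiniteMeasure_withDensity_ofReal (hi i).2
  refine Measure.pi_eq fun A hA => ?_
  rw [withDensity_apply _ (MeasurableSet.univ_pi hA), volume_pi, Measure.restrict_pi_pi,
    ← ofReal_integral_eq_lintegral_ofReal (Integrable.fintype_prod fun i => (hi i).restrict)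
      (Eventually.of_forall fun x => Finset.prod_nonneg fun i _ => hf i _),
    integral_fintype_prod_eq_prod, ENNReal.ofReal_prod_of_nonneg
      (fun i _ => integral_nonneg (hf i))]
  refine Finset.prod_congr rfl fun i _ => ?_
  rw [withDensity_apply _ (hA i), ofReal_integral_eq_lintegral_ofReal (hi i).restrict
    (Eventually.of_forall (hf i))]

lemma sequenceLaw_eq_withDensity {n : ℕ} (θ : Fin n → ℝ) :
    sequenceLaw θ = volume.withDensity fun x : Fin n → ℝ =>
      ENNReal.ofReal (∏ i, gaussianPDFReal (θ i) 1 (x i)) := by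
  rw [← pi_withDensity_ofReal (fun i => gaussianPDFReal (θ i) 1)
    (fun i => gaussianPDFReal_nonneg _ _) fun i => integrable_gaussianPDFReal _ _]
  unfold sequenceLaw
  congr 1
  ext1 i
  rw [gaussianReal_of_var_ne_zero _ one_ne_zero]
  rfl

/-- Rearrangement inequality for a single transposition. -/
lemma sum_mul_le_sum_mul_swap {ι : Type*} [Fintype ι] [DecidableEq ι] (θ x : ι → ℝ) (i j : ι)
    (hθ : θ j ≤ θ i) (hx : x i ≤ x j) :
    ∑ k, x k * θ k ≤ ∑ k, x k * θ (Equiv.swap i j k) := by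
  rcases eq_or_ne i j with rfl | hij
  · simp
  rw [← sub_nonneg, ← Finset.sum_sub_distrib, Finset.sum_eq_add i j hij]
  · simp only [Equiv.swap_apply_left, Equiv.swap_apply_right]
    nlinarith [mul_nonneg (sub_nonneg.2 hθ) (sub_nonneg.2 hx)]
  · rintro k - ⟨h1, h2⟩
    rw [Equiv.swap_apply_of_ne_of_ne h1 h2, sub_self]
  · simp
  · simp

/-- Exchanging a mean with a smaller one increases the probability of an event on which the
corresponding observations are in the opposite order. -/
lemma sequenceLaw_real_le_swap {n : ℕ} (θ : Fin n → ℝ) (i j : Fin n) (hθ : θ j ≤ θ i)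
    {B : Set (Fin n → ℝ)} (hB : MeasurableSet B) (hBij : ∀ x ∈ B, x i ≤ x j) :
    (sequenceLaw θ).real B ≤ (sequenceLaw (θ ∘ Equiv.swap i j)).real B := by
  refine ENNReal.toReal_mono (measure_ne_top _ _) ?_
  rw [sequenceLaw_eq_withDensity, sequenceLaw_eq_withDensity, withDensity_apply _ hB,
    withDensity_apply _ hB]
  refine setLIntegral_mono' hB fun x hx => ENNReal.ofReal_le_ofReal ?_
  -- The exchange preserves the normalising constants and `∑ θ_k²`, so the densities compare through
  -- the cross term `∑ x_k θ_k` alone.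
  simp only [gaussianPDFReal, Finset.prod_mul_distrib, ← Real.exp_sum, Function.comp]
  refine mul_le_mul_of_nonneg_left (Real.exp_le_exp.2 ?_) (by positivity)
  rw [← Finset.sum_div, ← Finset.sum_div]
  refine div_le_div_of_nonneg_right ?_ (by norm_num)
  have h := sum_mul_le_sum_mul_swap θ x i j hθ (hBij x hx)
  have e : ∑ k, θ (Equiv.swap i j k) ^ 2 = ∑ k, θ k ^ 2 :=
    Equiv.sum_comp (Equiv.swap i j) fun k => θ k ^ 2
  simp only [sub_sq, Finset.sum_neg_distrib, Finset.sum_add_distrib, Finset.sum_sub_distrib,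
    mul_assoc, ← Finset.mul_sum]
  linarith

/-! ### Lower bound for the weighted classification risk -/

/-- Classification risk in which false positives have weight `w`. -/
noncomputable def weightedRisk {n : ℕ} (w : ℝ) (θ : Fin n → ℝ) (φ : Procedure n) : ℝ :=
  (∫ X, (numFN θ (φ.1 X) : ℝ) ∂(sequenceLaw θ)) + w * ∫ X, (numFP θ (φ.1 X) : ℝ) ∂(sequenceLaw θ)

/-- The vector equal to `a` on `S` and to `0` elsewhere. -/
def spike {n : ℕ} (S : Finset (Fin n)) (a : ℝ) : Fin n → ℝ := fun i => if i ∈ S then a else 0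

lemma spike_perm_ne_zero_iff {n : ℕ} (S : Finset (Fin n)) {a : ℝ} (ha : a ≠ 0)
    (σ : Equiv.Perm (Fin n)) (i : Fin n) : (spike S a ∘ σ) i ≠ 0 ↔ σ i ∈ S := by
  simp [spike, ha]

lemma sum_spike_ne_zero {n : ℕ} (S : Finset (Fin n)) {a : ℝ} (ha : a ≠ 0)
    (σ : Equiv.Perm (Fin n)) (f : Fin n → ℝ) :
    ∑ i with (spike S a ∘ σ) i ≠ 0, f i = ∑ k ∈ S, f (σ.symm k) := by
  simp_rw [spike_perm_ne_zero_iff S ha]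
  refine Finset.sum_nbij' σ σ.symm ?_ ?_ ?_ ?_ ?_ <;> simp

lemma sum_spike_eq_zero {n : ℕ} (S : Finset (Fin n)) {a : ℝ} (ha : a ≠ 0)
    (σ : Equiv.Perm (Fin n)) (f : Fin n → ℝ) :
    ∑ i with (spike S a ∘ σ) i = 0, f i = ∑ k ∈ Sᶜ, f (σ.symm k) := by
  have h : ∀ i, (spike S a ∘ σ) i = 0 ↔ σ i ∈ Sᶜ := fun i => by
    rw [Finset.mem_compl, ← spike_perm_ne_zero_iff S ha, not_not]
  simp_rw [h]
  refine Finset.sum_nbij' σ σ.symm ?_ ?_ ?_ ?_ ?_ <;> simp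

lemma numNonzero_spike {n : ℕ} (S : Finset (Fin n)) {a : ℝ} (ha : a ≠ 0)
    (σ : Equiv.Perm (Fin n)) : numNonzero (spike S a ∘ σ) = S.card := by
  have h := sum_spike_ne_zero S ha σ fun _ => 1
  simp only [Finset.sum_const, nsmul_eq_mul, mul_one] at h
  exact_mod_cast h

/-- Averaging over all permutations of the signal positions: the probability that a signal is
exceeded by many null observations bounds the weighted risk from below. -/
lemma card_mul_le_of_weightedRisk_le {n : ℕ} (S : Finset (Fin n)) (hS : S.Nonempty) {a w r q : ℝ}
    (ha : 0 < a) (hw : 0 < w) (φ : Procedure n)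
    (hr : ∀ σ : Equiv.Perm (Fin n), weightedRisk w (spike S a ∘ σ) φ ≤ r)
    (hq : ∀ σ : Equiv.Perm (Fin n), ∀ k ∈ S, q ≤ (sequenceLaw (spike S a ∘ σ)).real
      {x | (S.card : ℝ) / w ≤ ((Sᶜ.filter fun l => x (σ.symm k) ≤ x (σ.symm l)).card : ℝ)}) :
    S.card * q ≤ r := by
  have hc : 0 < (S.card : ℝ) := by exact_mod_cast hS.card_pos
  set P : Equiv.Perm (Fin n) → Measure (Fin n → ℝ) := fun σ => sequenceLaw (spike S a ∘ σ) with hP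
  have hPp : ∀ σ, IsProbabilityMeasure (P σ) := fun σ => by simp only [hP]; infer_instance
  set F : Equiv.Perm (Fin n) → Fin n → ℝ := fun σ k => (P σ).real {X | φ.1 X (σ.symm k) = false}
  set T : Equiv.Perm (Fin n) → Fin n → ℝ := fun σ k => (P σ).real {X | φ.1 X (σ.symm k) = true}
  have hrisk : ∀ σ, ∑ k ∈ S, F σ k + w * ∑ l ∈ Sᶜ, T σ l ≤ r := by
    intro σ
    refine le_trans (le_of_eq ?_) (hr σ)
    rw [weightedRisk, integral_numFN, integral_numFP, sum_spike_ne_zero S ha.ne',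
      sum_spike_eq_zero S ha.ne']
  set Q : Equiv.Perm (Fin n) → Fin n → Fin n → ℝ := fun σ k l =>
    (P σ).real ({X | φ.1 X (σ.symm k) = true} ∩ {X | X (σ.symm k) ≤ X (σ.symm l)})
  have hmT : ∀ i, MeasurableSet {X | φ.1 X i = true} := fun i => φ.measurableSet {d | d i = true}
  have hmL : ∀ i j, MeasurableSet {X : Fin n → ℝ | X i ≤ X j} := fun i j =>
    measurableSet_le (measurable_pi_apply i) (measurable_pi_apply j)
  -- After the exchange, the position `σ⁻¹ k` of the former signal carries the null label `l`;
  -- rejecting there is a false positive.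
  have hQ : ∀ σ, ∀ k ∈ S, ∀ l ∈ Sᶜ, Q σ k l ≤ T (Equiv.swap k l * σ) l := by
    intro σ k hk l hl
    have hk' : (spike S a ∘ σ) (σ.symm k) = a := by simp [spike, hk]
    have hl' : (spike S a ∘ σ) (σ.symm l) = 0 := by simp [spike, Finset.mem_compl.1 hl]
    have h := sequenceLaw_real_le_swap (spike S a ∘ σ) (σ.symm k) (σ.symm l)
      (by rw [hk', hl']; exact ha.le)
      ((hmT (σ.symm k)).inter (hmL (σ.symm k) (σ.symm l))) fun x hx => hx.2
    refine h.trans ((measureReal_mono Set.inter_subset_left).trans (le_of_eq ?_))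
    have e1 : (spike S a ∘ σ) ∘ Equiv.swap (σ.symm k) (σ.symm l)
        = spike S a ∘ (Equiv.swap k l * σ : Equiv.Perm (Fin n)) := by
      rw [Equiv.swap_mul_eq_mul_swap]
      rfl
    have e2 : (Equiv.swap k l * σ : Equiv.Perm (Fin n)).symm l = σ.symm k := by
      rw [Equiv.symm_apply_eq]
      simp
    simp only [T, P, e1, e2]
  -- Either the signal is missed, or it is rejected while at least `|S| / w` nulls exceed it;
  -- Markov's inequality for the number of these nulls bounds the second case.
  have hE : ∀ σ, ∀ k ∈ S, q ≤ F σ k + w / S.card * ∑ l ∈ Sᶜ, Q σ k l := by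
    intro σ k hk
    refine (hq σ k hk).trans ?_
    set E := {x : Fin n → ℝ |
      (S.card : ℝ) / w ≤ ((Sᶜ.filter fun l => x (σ.symm k) ≤ x (σ.symm l)).card : ℝ)} with hEdef
    have h1 : (P σ).real E ≤ F σ k + (P σ).real ({X | φ.1 X (σ.symm k) = true} ∩ E) := by
      refine (measureReal_mono fun x hx => ?_).trans (measureReal_union_le _ _)
      rcases h : φ.1 x (σ.symm k) with _ | _
      · exact Or.inl h
      · exact Or.inr ⟨h, hx⟩
    refine h1.trans (add_le_add le_rfl ?_)
    have hint : ∀ l, Integrable (({X | φ.1 X (σ.symm k) = true} ∩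
        {X | X (σ.symm k) ≤ X (σ.symm l)}).indicator fun _ => (1 : ℝ)) (P σ) := fun l =>
      (integrable_const 1).indicator ((hmT _).inter (hmL _ _))
    have h2 : (S.card : ℝ) / w * (P σ).real ({X | φ.1 X (σ.symm k) = true} ∩ E)
        ≤ ∑ l ∈ Sᶜ, Q σ k l := by
      have h3 : ∑ l ∈ Sᶜ, Q σ k l = ∫ x, ∑ l ∈ Sᶜ, ({X | φ.1 X (σ.symm k) = true} ∩
          {X | X (σ.symm k) ≤ X (σ.symm l)}).indicator (fun _ => (1 : ℝ)) x ∂(P σ) := by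
        rw [integral_finsetSum _ fun l _ => hint l]
        exact Finset.sum_congr rfl fun l _ =>
          (integral_indicator_one ((hmT _).inter (hmL _ _))).symm
      rw [h3]
      refine le_trans ?_ (mul_meas_ge_le_integral_of_nonneg (μ := P σ)
        (Eventually.of_forall fun x => Finset.sum_nonneg fun l _ =>
          Set.indicator_nonneg (fun _ _ => zero_le_one) x)
        (integrable_finsetSum _ fun l _ => hint l) ((S.card : ℝ) / w))
      refine mul_le_mul_of_nonneg_left (measureReal_mono fun x hx => ?_) (by positivity)
      have hx2 := hx.2
      rw [hEdef, Set.mem_ofPred_eq] at hx2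
      refine le_trans hx2 (le_of_eq ?_)
      have hx1 : φ.1 x (σ.symm k) = true := hx.1
      simp [Set.indicator_apply, Finset.sum_boole, hx1]
    rw [div_mul_eq_mul_div, div_le_iff₀ hw] at h2
    rw [div_mul_eq_mul_div, le_div_iff₀ hc]
    linarith
  have hsum : ∑ _σ : Equiv.Perm (Fin n), ∑ _k ∈ S, q
      ≤ ∑ σ : Equiv.Perm (Fin n), (∑ k ∈ S, F σ k + w * ∑ l ∈ Sᶜ, T σ l) := by
    -- For fixed `k` and `l`, `σ ↦ swap k l * σ` permutes the group, so the sum over `σ` of the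
    -- exchanged terms does not depend on `k`; the `|S|` choices of `k` cancel the factor `1 / |S|`.
    have hTl : ∑ σ, ∑ k ∈ S, w / S.card * ∑ l ∈ Sᶜ, Q σ k l
        ≤ ∑ σ, w * ∑ l ∈ Sᶜ, T σ l := by
      rw [Finset.sum_comm]
      have : ∀ k ∈ S, ∑ σ, w / S.card * ∑ l ∈ Sᶜ, Q σ k l
          ≤ w / S.card * ∑ σ, ∑ l ∈ Sᶜ, T σ l := by
        intro k hk
        rw [← Finset.mul_sum]
        refine mul_le_mul_of_nonneg_left ?_ (by positivity)
        rw [Finset.sum_comm, Finset.sum_comm (f := fun σ l => T σ l)]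
        refine Finset.sum_le_sum fun l hl => ?_
        refine (Finset.sum_le_sum fun σ _ => hQ σ k hk l hl).trans (le_of_eq ?_)
        exact Equiv.sum_comp (Equiv.mulLeft (Equiv.swap k l)) fun σ => T σ l
      refine (Finset.sum_le_sum this).trans (le_of_eq ?_)
      rw [Finset.sum_const, nsmul_eq_mul, ← mul_assoc, mul_div_cancel₀ _ hc.ne', Finset.mul_sum]
    calc _ ≤ ∑ σ, ∑ k ∈ S, (F σ k + w / S.card * ∑ l ∈ Sᶜ, Q σ k l) :=
          Finset.sum_le_sum fun σ _ => Finset.sum_le_sum fun k hk => hE σ k hk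
      _ = ∑ σ, ∑ k ∈ S, F σ k + ∑ σ, ∑ k ∈ S, w / S.card * ∑ l ∈ Sᶜ, Q σ k l := by
          simp_rw [Finset.sum_add_distrib]
      _ ≤ _ := by rw [Finset.sum_add_distrib]; exact add_le_add le_rfl hTl
  have h := hsum.trans (Finset.sum_le_sum fun σ _ => hrisk σ)
  simp only [Finset.sum_const, nsmul_eq_mul] at h
  exact le_of_mul_le_mul_left h (by exact_mod_cast Fintype.card_pos)

/-- Lower bound for the maximal weighted risk over the vectors with `s` nonzero coordinates, all
equal to `a`. -/
lemma le_of_weightedRisk_le {n s : ℕ} (hs : 1 ≤ s) (hsn : s ≤ n) {a u w r : ℝ} (ha : 0 < a)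
    (hw : 0 < w) (hu : 2 * (s / w) ≤ (n - s) * gaussianTail (u : EReal)) (φ : Procedure n)
    (hr : ∀ θ : Fin n → ℝ, numNonzero θ = s → (∀ i, θ i ≠ 0 → θ i = a) →
      weightedRisk w θ φ ≤ r) :
    s * gaussianTail ((a - u : ℝ) : EReal) - 2 * w ≤ r := by
  classical
  obtain ⟨S, -, hS⟩ := Finset.exists_subset_card_eq (s := (Finset.univ : Finset (Fin n)))
    (n := s) (by simpa using hsn)
  have hs0 : (0 : ℝ) < s := by exact_mod_cast hs
  have hSne : S.Nonempty := Finset.card_pos.1 (by omega)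
  have hr' : ∀ σ : Equiv.Perm (Fin n), weightedRisk w (spike S a ∘ σ) φ ≤ r := fun σ =>
    hr _ (by rw [numNonzero_spike S ha.ne', hS]) fun i hi => by
      have := (spike_perm_ne_zero_iff S ha.ne' σ i).1 hi
      simp [spike, this]
  -- The subtracted term is the Chebyshev error at level `m = 2s/w`; multiplied by `s` it becomes
  -- `2w`.
  have key := card_mul_le_of_weightedRisk_le S hSne
    (q := gaussianTail ((a - u : ℝ) : EReal) - 4 / (2 * (s / w))) ha hw φ hr' fun σ k hk => ?_
  · rw [hS] at key
    refine le_trans (le_of_eq ?_) key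
    field_simp
    ring
  set P := sequenceLaw (spike S a ∘ σ)
  set J := Sᶜ.map σ.symm.toEmbedding with hJ
  have hcard : ((Sᶜ).card : ℝ) = n - s := by
    rw [Finset.card_compl, hS, Fintype.card_fin, Nat.cast_sub hsn]
  have hJsum : 2 * ((s : ℝ) / w) ≤ ∑ i ∈ J, (gaussianReal ((spike S a ∘ σ) i) 1).real (Set.Ici u) := by
    refine hu.trans (le_of_eq ?_)
    rw [hJ, Finset.sum_map]
    have : ∀ l ∈ Sᶜ, (gaussianReal ((spike S a ∘ σ) (σ.symm.toEmbedding l)) 1).real (Set.Ici u)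
        = gaussianTail (u : EReal) := by
      intro l hl
      have e : (spike S a ∘ σ) (σ.symm.toEmbedding l) = 0 := by
        simp [spike, Finset.mem_compl.1 hl]
      rw [e, gaussianReal_real_Ici, sub_zero]
    rw [Finset.sum_congr rfl this, Finset.sum_const, nsmul_eq_mul, hcard]
  have hcheb := pi_real_card_le (fun i => gaussianReal ((spike S a ∘ σ) i) 1) J
    (A := fun _ => Set.Ici u) (fun _ => measurableSet_Ici) (by positivity) hJsum
  have hX : P.real {X | X (σ.symm k) ∈ Set.Iio u} = gaussianTail ((a - u : ℝ) : EReal) := by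
    have e : (spike S a ∘ σ) (σ.symm k) = a := by simp [spike, hk]
    rw [sequenceLaw_real_eval _ _ measurableSet_Iio, e, gaussianReal_real_Iio]
  rw [← hX, sub_le_iff_le_add]
  refine le_trans ?_ (add_le_add le_rfl hcheb)
  -- If the signal lies below `u`, either few nulls reach `u`, which is the Chebyshev event, or at
  -- least `s/w` nulls exceed the signal.
  refine (measureReal_mono fun x hx => ?_).trans (measureReal_union_le _ _)
  by_cases h : ((J.filter fun i => x i ∈ Set.Ici u).card : ℝ) ≤ 2 * (s / w) / 2
  · refine Or.inr ?_
    rw [Set.mem_ofPred_eq]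
    convert h
  · left
    rw [not_le, mul_div_cancel_left₀ _ two_ne_zero] at h
    rw [Set.mem_ofPred_eq, hS]
    refine h.le.trans ?_
    rw [hJ, Finset.filter_map, Finset.card_map]
    refine Nat.cast_le.2 (Finset.card_le_card fun l hl => ?_)
    rw [Finset.mem_filter] at hl ⊢
    refine ⟨hl.1, ?_⟩
    have h1 : x (σ.symm k) < u := hx
    have h2 : u ≤ x (σ.symm l) := hl.2
    exact h1.le.trans h2

/-! ### Counts and risks -/

lemma numFP_le_numDisc {n : ℕ} (θ : Fin n → ℝ) (d : Fin n → Bool) : numFP θ d ≤ numDisc d :=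
  Finset.card_le_card fun i hi => by
    simp only [Finset.mem_filter] at hi ⊢
    exact ⟨hi.1, hi.2.2⟩

lemma numFN_le_numNonzero {n : ℕ} (θ : Fin n → ℝ) (d : Fin n → Bool) :
    numFN θ d ≤ numNonzero θ :=
  Finset.card_le_card fun i hi => by
    simp only [Finset.mem_filter] at hi ⊢
    exact ⟨hi.1, hi.2.1⟩

lemma numDisc_le {n : ℕ} (d : Fin n → Bool) : numDisc d ≤ n :=
  (Finset.card_le_univ _).trans_eq (Fintype.card_fin n)

lemma numNonzero_le {n : ℕ} (θ : Fin n → ℝ) : numNonzero θ ≤ n :=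
  (Finset.card_le_univ _).trans_eq (Fintype.card_fin n)

lemma numDisc_le_numFP_add {n : ℕ} (θ : Fin n → ℝ) (d : Fin n → Bool) :
    numDisc d ≤ numFP θ d + numNonzero θ := by
  refine (Finset.card_le_card fun i hi => ?_).trans (Finset.card_union_le _ _)
  simp only [Finset.mem_filter, Finset.mem_union, Finset.mem_univ, true_and] at hi ⊢
  tauto

lemma numFP_false {n : ℕ} (θ : Fin n → ℝ) : numFP θ (fun _ => false) = 0 := by
  simp [numFP]

lemma numFN_false {n : ℕ} (θ : Fin n → ℝ) : numFN θ (fun _ => false) = numNonzero θ := by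
  simp [numFN, numNonzero]

lemma fdp_nonneg {n : ℕ} (θ : Fin n → ℝ) (d : Fin n → Bool) :
    0 ≤ (numFP θ d : ℝ) / max 1 (numDisc d : ℝ) := by positivity

lemma fdp_le_one {n : ℕ} (θ : Fin n → ℝ) (d : Fin n → Bool) :
    (numFP θ d : ℝ) / max 1 (numDisc d : ℝ) ≤ 1 := by
  refine div_le_one_of_le₀ (le_trans ?_ (le_max_right _ _)) (by positivity)
  exact_mod_cast numFP_le_numDisc θ d

lemma fnp_le_one {n : ℕ} (θ : Fin n → ℝ) (d : Fin n → Bool) :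
    (numFN θ d : ℝ) / max 1 (numNonzero θ : ℝ) ≤ 1 := by
  refine div_le_one_of_le₀ (le_trans ?_ (le_max_right _ _)) (by positivity)
  exact_mod_cast numFN_le_numNonzero θ d

lemma Procedure.integral_le {n : ℕ} (φ : Procedure n) (θ : Fin n → ℝ) (g : (Fin n → Bool) → ℝ)
    (c : ℝ) (hg : ∀ d, g d ≤ c) : ∫ X, g (φ.1 X) ∂(sequenceLaw θ) ≤ c := by
  refine (integral_mono (φ.integrable g _) (integrable_const c) fun X => hg _).trans (le_of_eq ?_)
  simp

lemma testingRisk_nonneg {n : ℕ} (θ : Fin n → ℝ) (φ : Procedure n) : 0 ≤ testingRisk θ φ :=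
  add_nonneg (integral_nonneg fun _ => fdp_nonneg _ _) (integral_nonneg fun _ => by positivity)

lemma testingRisk_le_two {n : ℕ} (θ : Fin n → ℝ) (φ : Procedure n) : testingRisk θ φ ≤ 2 := by
  have h1 := φ.integral_le θ (fun d => (numFP θ d : ℝ) / max 1 (numDisc d : ℝ)) 1 (fdp_le_one θ)
  have h2 := φ.integral_le θ (fun d => (numFN θ d : ℝ) / max 1 (numNonzero θ : ℝ)) 1
    (fnp_le_one θ)
  unfold testingRisk FDR FNR
  linarith

lemma classificationRisk_nonneg {n : ℕ} (θ : Fin n → ℝ) (φ : Procedure n) :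
    0 ≤ classificationRisk θ φ :=
  add_nonneg (integral_nonneg fun _ => by positivity) (integral_nonneg fun _ => by positivity)

lemma classificationRisk_le {n : ℕ} (θ : Fin n → ℝ) (φ : Procedure n) :
    classificationRisk θ φ ≤ n + n := by
  refine add_le_add (φ.integral_le θ (fun d => (numFP θ d : ℝ)) n fun d => ?_)
    (φ.integral_le θ (fun d => (numFN θ d : ℝ)) n fun d => ?_)
  · exact_mod_cast (numFP_le_numDisc θ d).trans (numDisc_le d)
  · exact_mod_cast (numFN_le_numNonzero θ d).trans (numNonzero_le θ)

lemma weightedRisk_one {n : ℕ} (θ : Fin n → ℝ) (φ : Procedure n) :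
    weightedRisk 1 θ φ = classificationRisk θ φ := by
  rw [weightedRisk, classificationRisk, one_mul, add_comm]

/-- The procedure that never rejects. -/
def neverReject (n : ℕ) : Procedure n := ⟨fun _ _ => false, measurable_const⟩

instance (n : ℕ) : Nonempty (Procedure n) := ⟨neverReject n⟩

/-- Nonnegativity of `R` bounds the infimum below; `0 ≤ c` covers the empty class, whose supremum is
0. -/
lemma minimaxRisk_le {n : ℕ} {R : (Fin n → ℝ) → Procedure n → ℝ} {Θ : Set (Fin n → ℝ)} {c : ℝ}
    (hR : ∀ θ φ, 0 ≤ R θ φ) (hc : 0 ≤ c) (φ : Procedure n) (h : ∀ θ ∈ Θ, R θ φ ≤ c) :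
    minimaxRisk R Θ ≤ c := by
  refine (ciInf_le ⟨0, ?_⟩ φ).trans (Real.iSup_le (fun θ => h θ θ.2) hc)
  rintro _ ⟨ψ, rfl⟩
  exact Real.iSup_nonneg fun θ => hR _ _

/-- The uniform bound `B` makes the suprema genuine: a real supremum of an unbounded family would
default to 0. -/
lemma le_minimaxRisk {n : ℕ} {R : (Fin n → ℝ) → Procedure n → ℝ} {Θ : Set (Fin n → ℝ)} {c B : ℝ}
    (hR : ∀ θ φ, R θ φ ≤ B) (h : ∀ φ r, (∀ θ ∈ Θ, R θ φ ≤ r) → c ≤ r) :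
    c ≤ minimaxRisk R Θ := by
  refine le_ciInf fun φ => h φ _ fun θ hθ => ?_
  refine le_ciSup (f := fun θ : Θ => R θ φ) ⟨B, ?_⟩ ⟨θ, hθ⟩
  rintro _ ⟨ψ, rfl⟩
  exact hR _ _

lemma minimaxRisk_nonneg {n : ℕ} {R : (Fin n → ℝ) → Procedure n → ℝ} {Θ : Set (Fin n → ℝ)}
    (hR : ∀ θ φ, 0 ≤ R θ φ) : 0 ≤ minimaxRisk R Θ :=
  Real.iInf_nonneg fun _ => Real.iSup_nonneg fun _ => hR _ _

lemma minimaxTesting_nonneg (n s : ℕ) (b : EReal) : 0 ≤ minimaxTesting n s b :=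
  minimaxRisk_nonneg testingRisk_nonneg

lemma normalisedRisk_nonneg {n : ℕ} (s : ℕ) (θ : Fin n → ℝ) (φ : Procedure n) :
    0 ≤ classificationRisk θ φ / s :=
  div_nonneg (classificationRisk_nonneg θ φ) s.cast_nonneg

lemma minimaxClassification_nonneg (n s : ℕ) (b : EReal) : 0 ≤ minimaxClassification n s b :=
  minimaxRisk_nonneg (normalisedRisk_nonneg s)

/-! ### The signal class -/

/-- With `s = 0` the zero vector would belong to the class. -/
lemma signalClass_top {n s : ℕ} (hs : 1 ≤ s) : signalClass n s ⊤ = ∅ := by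
  rw [Set.eq_empty_iff_forall_notMem]
  rintro θ ⟨-, h1, h2⟩
  have h3 : 0 < numNonzero θ := by omega
  obtain ⟨i, hi⟩ := Finset.card_pos.1 h3
  have h4 := h2 i (Finset.mem_filter.1 hi).2
  rw [EReal.coe_add_top, top_le_iff] at h4
  exact EReal.coe_ne_top _ h4

lemma mem_signalClass_coe {n s : ℕ} {b : ℝ} {θ : Fin n → ℝ} (h : θ ∈ signalClass n s b) :
    numNonzero θ = s ∧ ∀ i, θ i ≠ 0 → √(2 * Real.log ((n : ℝ) / s)) + b ≤ |θ i| :=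
  ⟨h.2.1, fun i hi => by exact_mod_cast h.2.2 i hi⟩

lemma mem_signalClass_of_eq {n s : ℕ} {b : EReal} {b' : ℝ} (hb : b ≤ b') {θ : Fin n → ℝ}
    (h : numNonzero θ = s)
    (hθ : ∀ i, θ i ≠ 0 → θ i = √(2 * Real.log ((n : ℝ) / s)) + b') :
    θ ∈ signalClass n s b := by
  refine ⟨h.le, h, fun i hi => ?_⟩
  refine (add_le_add le_rfl hb).trans ?_
  rw [← EReal.coe_add, EReal.coe_le_coe_iff, ← hθ i hi]
  exact le_abs_self _

/-! ### Upper bounds -/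

lemma minimaxTesting_le_one (n s : ℕ) (b : EReal) : minimaxTesting n s b ≤ 1 := by
  refine minimaxRisk_le testingRisk_nonneg zero_le_one (neverReject n) fun θ _ => ?_
  have h1 : FDR θ (neverReject n) = 0 := by simp [FDR, neverReject, numFP_false]
  rw [testingRisk, h1, zero_add]
  exact (neverReject n).integral_le θ (fun d => (numFN θ d : ℝ) / max 1 (numNonzero θ : ℝ)) 1
    (fnp_le_one θ)

lemma minimaxClassification_le_one (n s : ℕ) (b : EReal) : minimaxClassification n s b ≤ 1 := by
  refine minimaxRisk_le (normalisedRisk_nonneg s) zero_le_one (neverReject n) fun θ hθ => ?_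
  refine div_le_one_of_le₀ (le_of_eq ?_) s.cast_nonneg
  simp [classificationRisk, neverReject, numFP_false, numFN_false, hθ.2.1]

lemma minimaxTesting_top {n s : ℕ} (hs : 1 ≤ s) : minimaxTesting n s ⊤ ≤ 0 :=
  minimaxRisk_le testingRisk_nonneg le_rfl (neverReject n) fun θ hθ => by
    simp [signalClass_top hs] at hθ

lemma minimaxClassification_top {n s : ℕ} (hs : 1 ≤ s) : minimaxClassification n s ⊤ ≤ 0 :=
  minimaxRisk_le (normalisedRisk_nonneg s) le_rfl (neverReject n) fun θ hθ => by
    simp [signalClass_top hs] at hθ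

/-- Rejection of the null hypotheses for which `|X_i| ≥ τ`. -/
noncomputable def thresholding (n : ℕ) (τ : ℝ) : Procedure n :=
  ⟨fun X i => decide (τ ≤ |X i|), measurable_pi_lambda _ fun i =>
    measurable_to_bool (by
      have h : MeasurableSet {X : Fin n → ℝ | τ ≤ |X i|} :=
        measurableSet_le measurable_const (by fun_prop)
      convert h using 1
      ext X
      simp)⟩

lemma integral_numFP_thresholding_le {n : ℕ} (θ : Fin n → ℝ) (τ : ℝ) :
    ∫ X, (numFP θ ((thresholding n τ).1 X) : ℝ) ∂(sequenceLaw θ)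
      ≤ n * (2 * gaussianTail (τ : EReal)) := by
  rw [integral_numFP]
  refine (Finset.sum_le_card_nsmul _ _ (2 * gaussianTail (τ : EReal)) fun i hi => ?_).trans ?_
  · have h := sequenceLaw_real_eval θ i (A := {x | τ ≤ |x|})
      (measurableSet_le measurable_const (by fun_prop))
    simp only [Finset.mem_filter, Finset.mem_univ, true_and] at hi
    simp only [thresholding, decide_eq_true_eq]
    refine h.le.trans ?_
    rw [hi]
    exact gaussianReal_zero_real_abs_ge τ
  · rw [nsmul_eq_mul]
    refine mul_le_mul_of_nonneg_right ?_ (by have := gaussianTail_nonneg (τ : EReal); positivity)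
    exact_mod_cast (Finset.card_le_univ _).trans_eq (Fintype.card_fin n)

lemma measurableSet_abs_lt (τ : ℝ) : MeasurableSet {x : ℝ | |x| < τ} :=
  measurableSet_lt (by fun_prop) measurable_const

lemma gaussianReal_real_abs_lt_of_mem {n s : ℕ} {b : ℝ} {θ : Fin n → ℝ}
    (hθ : θ ∈ signalClass n s b) (δ : ℝ) {i : Fin n} (hi : θ i ≠ 0) :
    (gaussianReal (θ i) 1).real {x | |x| < √(2 * Real.log ((n : ℝ) / s)) + δ}
      ≤ gaussianTail ((b - δ : ℝ) : EReal) := by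
  refine (gaussianReal_real_abs_lt _ _).trans (gaussianTail_antitone ?_)
  rw [EReal.coe_le_coe_iff]
  linarith [(mem_signalClass_coe hθ).2 i hi]

lemma integral_numFN_thresholding_le {n s : ℕ} {b : ℝ} {θ : Fin n → ℝ}
    (hθ : θ ∈ signalClass n s b) (δ : ℝ) :
    ∫ X, (numFN θ ((thresholding n (√(2 * Real.log ((n : ℝ) / s)) + δ)).1 X) : ℝ) ∂(sequenceLaw θ)
      ≤ s * gaussianTail ((b - δ : ℝ) : EReal) := by
  rw [integral_numFN]
  refine (Finset.sum_le_card_nsmul _ _ (gaussianTail ((b - δ : ℝ) : EReal)) fun i hi => ?_).trans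
    (le_of_eq ?_)
  · simp only [Finset.mem_filter, Finset.mem_univ, true_and] at hi
    refine le_trans ?_ (gaussianReal_real_abs_lt_of_mem hθ δ hi)
    simp only [thresholding, decide_eq_false_iff_not, not_le]
    exact (sequenceLaw_real_eval θ i (measurableSet_abs_lt _)).le
  · rw [nsmul_eq_mul]
    congr 2
    exact (mem_signalClass_coe hθ).1

/-- Under the universal threshold, enlarged by `δ`, few null observations remain. -/
lemma nat_mul_gaussianTail_le {n s : ℕ} (hs : 1 ≤ s) (hsn : s ≤ n) {δ : ℝ} (hδ : 0 ≤ δ) :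
    n * gaussianTail ((√(2 * Real.log ((n : ℝ) / s)) + δ : ℝ) : EReal)
      ≤ s * Real.exp (-(√(2 * Real.log ((n : ℝ) / s)) * δ)) := by
  have hs0 : (0 : ℝ) < s := by exact_mod_cast hs
  have hn0 : (0 : ℝ) < n := by exact_mod_cast hs.trans hsn
  have h1 : 1 ≤ (n : ℝ) / s := (one_le_div hs0).2 (by exact_mod_cast hsn)
  set t := √(2 * Real.log ((n : ℝ) / s)) with ht
  have ht2 : t ^ 2 = 2 * Real.log ((n : ℝ) / s) :=
    Real.sq_sqrt (by have := Real.log_nonneg h1; positivity)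
  have ht0 : 0 ≤ t := Real.sqrt_nonneg _
  have hexp : Real.exp (-t ^ 2 / 2) = s / n := by
    have : -t ^ 2 / 2 = -Real.log ((n : ℝ) / s) := by rw [neg_div, ht2]; ring
    rw [this, Real.exp_neg, Real.exp_log (by positivity), inv_div]
  calc n * gaussianTail ((t + δ : ℝ) : EReal)
      ≤ n * Real.exp (-(t + δ) ^ 2 / 2) := by
        gcongr
        exact gaussianTail_le_exp _ (by positivity)
    _ ≤ n * Real.exp (-t ^ 2 / 2 + -(t * δ)) := by
        gcongr
        nlinarith [sq_nonneg δ]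
    _ = s * Real.exp (-(t * δ)) := by
        rw [Real.exp_add, hexp]
        field_simp

lemma minimaxClassification_le {n s : ℕ} (hs : 1 ≤ s) (hsn : s ≤ n) (b : ℝ) {δ : ℝ} (hδ : 0 ≤ δ) :
    minimaxClassification n s b ≤ gaussianTail ((b - δ : ℝ) : EReal)
      + 2 * Real.exp (-(√(2 * Real.log ((n : ℝ) / s)) * δ)) := by
  have hs0 : (0 : ℝ) < s := by exact_mod_cast hs
  refine minimaxRisk_le (normalisedRisk_nonneg s)
    (add_nonneg (gaussianTail_nonneg _) (by positivity))
    (thresholding n (√(2 * Real.log ((n : ℝ) / s)) + δ)) fun θ hθ => ?_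
  rw [div_le_iff₀ hs0, classificationRisk]
  have h1 := integral_numFP_thresholding_le θ (√(2 * Real.log ((n : ℝ) / s)) + δ)
  have h2 := integral_numFN_thresholding_le hθ δ
  have h3 := nat_mul_gaussianTail_le hs hsn hδ
  linarith

/-- Each signal is detected with probability at least `p`, so outside an event of probability at
most `4 / (s p)` there are more than `s p / 2` discoveries. There the false discovery proportion is
at most `2 / (s p)` times the number of false positives; on the exceptional event it is at most 1.
-/
lemma minimaxTesting_le {n s : ℕ} (hs : 1 ≤ s) (hsn : s ≤ n) (b : ℝ) {δ p : ℝ} (hδ : 0 ≤ δ)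
    (hp : 0 < p) (hpb : gaussianTail ((b - δ : ℝ) : EReal) ≤ 1 - p) :
    minimaxTesting n s b ≤ gaussianTail ((b - δ : ℝ) : EReal) + 4 / (s * p)
      + 4 / p * Real.exp (-(√(2 * Real.log ((n : ℝ) / s)) * δ)) := by
  classical
  have hs0 : (0 : ℝ) < s := by exact_mod_cast hs
  set τ := √(2 * Real.log ((n : ℝ) / s)) + δ with hτ
  refine minimaxRisk_le testingRisk_nonneg
    (add_nonneg (add_nonneg (gaussianTail_nonneg _) (by positivity)) (by positivity))
    (thresholding n τ) fun θ hθ => ?_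
  have hcard := (mem_signalClass_coe hθ).1
  have h1 := integral_numFP_thresholding_le θ τ
  have h2 := integral_numFN_thresholding_le hθ δ
  have h3 := nat_mul_gaussianTail_le hs hsn hδ
  have hFNR : FNR θ (thresholding n τ) ≤ gaussianTail ((b - δ : ℝ) : EReal) := by
    have hmax : max 1 (numNonzero θ : ℝ) = s := by
      rw [hcard, max_eq_right (by exact_mod_cast hs)]
    rw [FNR, hmax, integral_div, div_le_iff₀ hs0]
    linarith
  set J := Finset.univ.filter fun i => θ i ≠ 0 with hJ
  have hJsum : s * p ≤ ∑ i ∈ J, (gaussianReal (θ i) 1).real {x | |x| < τ}ᶜ := by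
    have hJc : (J.card : ℝ) = s := by rw [← hcard]; rfl
    rw [← hJc, ← nsmul_eq_mul]
    refine Finset.card_nsmul_le_sum _ _ _ fun i hi => ?_
    have hi' : θ i ≠ 0 := (Finset.mem_filter.1 hi).2
    have := gaussianReal_real_abs_lt_of_mem hθ δ hi'
    rw [measureReal_compl (measurableSet_abs_lt τ), probReal_univ]
    linarith
  have hcheb := pi_real_card_le (fun i => gaussianReal (θ i) 1) J (A := fun _ => {x | |x| < τ}ᶜ)
    (fun _ => (measurableSet_abs_lt τ).compl) (by positivity) hJsum
  set D : Set (Fin n → Bool) := {d | ((J.filter fun i => d i = true).card : ℝ) ≤ s * p / 2}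
  have hD : (sequenceLaw θ).real {X | (thresholding n τ).1 X ∈ D} ≤ 4 / (s * p) := by
    refine le_trans (measureReal_mono fun X hX => ?_) hcheb
    have hX' : ((J.filter fun i => (thresholding n τ).1 X i = true).card : ℝ) ≤ s * p / 2 := hX
    rw [Set.mem_ofPred_eq]
    convert hX' using 5
    simp [thresholding]
  have hpt : ∀ d : Fin n → Bool, (numFP θ d : ℝ) / max 1 (numDisc d : ℝ)
      ≤ D.indicator (fun _ => (1 : ℝ)) d + 2 / (s * p) * numFP θ d := by
    intro d
    by_cases hd : d ∈ D
    · rw [Set.indicator_of_mem hd]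
      have := fdp_le_one θ d
      have : 0 ≤ 2 / (s * p) * numFP θ d := by positivity
      linarith
    · rw [Set.indicator_of_notMem hd, zero_add, div_mul_eq_mul_div, div_le_div_iff₀
        (by positivity) (by positivity)]
      have hd' : s * p / 2 < ((J.filter fun i => d i = true).card : ℝ) := not_le.1 hd
      have hle : ((J.filter fun i => d i = true).card : ℝ) ≤ numDisc d := by
        refine Nat.cast_le.2 (Finset.card_le_card fun i hi => ?_)
        simp only [Finset.mem_filter, Finset.mem_univ, true_and] at hi ⊢
        exact hi.2
      have : s * p ≤ 2 * max 1 (numDisc d : ℝ) := by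
        linarith [le_max_right (1 : ℝ) (numDisc d : ℝ)]
      nlinarith [mul_le_mul_of_nonneg_left this (Nat.cast_nonneg (α := ℝ) (numFP θ d))]
  have hFDR : FDR θ (thresholding n τ) ≤ (sequenceLaw θ).real {X | (thresholding n τ).1 X ∈ D}
      + 2 / (s * p) * ∫ X, (numFP θ ((thresholding n τ).1 X) : ℝ) ∂(sequenceLaw θ) := by
    have hi1 := (thresholding n τ).integrable (D.indicator fun _ => (1 : ℝ)) (sequenceLaw θ)
    have hi2 := (thresholding n τ).integrable (fun d => 2 / (s * p) * (numFP θ d : ℝ))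
      (sequenceLaw θ)
    refine (integral_mono ((thresholding n τ).integrable (fun d => (numFP θ d : ℝ) /
      max 1 (numDisc d : ℝ)) _) (hi1.add hi2) fun X => hpt _).trans (le_of_eq ?_)
    simp only [Pi.add_apply]
    rw [integral_add hi1 hi2, integral_const_mul]
    congr 1
    exact integral_indicator_one ((thresholding n τ).measurableSet D)
  have hfin : 2 / (s * p) * ∫ X, (numFP θ ((thresholding n τ).1 X) : ℝ) ∂(sequenceLaw θ)
      ≤ 4 / p * Real.exp (-(√(2 * Real.log ((n : ℝ) / s)) * δ)) := by
    calc _ ≤ 2 / (s * p) * (2 * (s * Real.exp (-(√(2 * Real.log ((n : ℝ) / s)) * δ)))) := by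
          gcongr
          linarith
      _ = _ := by field_simp; norm_num
  rw [testingRisk]
  linarith

/-! ### Lower bounds -/

lemma le_minimaxClassification {n s : ℕ} (hs : 1 ≤ s) (hsn : s ≤ n) {b : EReal} {b' δ : ℝ}
    (hb : b ≤ b') (hb' : 0 < √(2 * Real.log ((n : ℝ) / s)) + b')
    (hu : 2 * (s / 1) ≤
      (n - s) * gaussianTail ((√(2 * Real.log ((n : ℝ) / s)) - δ : ℝ) : EReal)) :
    gaussianTail ((b' + δ : ℝ) : EReal) - 2 / s ≤ minimaxClassification n s b := by
  have hs0 : (0 : ℝ) < s := by exact_mod_cast hs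
  refine le_minimaxRisk (B := (n + n) / s)
    (fun θ φ => div_le_div_of_nonneg_right (classificationRisk_le θ φ) hs0.le) fun φ r hr => ?_
  have h := le_of_weightedRisk_le hs hsn hb' one_pos hu φ (r := s * r) fun θ h1 h2 => by
    have := hr θ (mem_signalClass_of_eq hb h1 h2)
    rw [div_le_iff₀ hs0] at this
    rw [weightedRisk_one]
    linarith
  have e : √(2 * Real.log ((n : ℝ) / s)) + b' - (√(2 * Real.log ((n : ℝ) / s)) - δ) = b' + δ := by
    ring
  rw [e] at h
  rw [sub_le_iff_le_add, ← sub_le_iff_le_add', le_div_iff₀ hs0]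
  linarith

/-- The procedure that agrees with `φ` when `φ` makes at most `L` discoveries and rejects nothing
otherwise. -/
noncomputable def Procedure.truncate {n : ℕ} (φ : Procedure n) (L : ℝ) : Procedure n :=
  ⟨fun X => (fun d : Fin n → Bool => if (numDisc d : ℝ) ≤ L then d else fun _ => false) (φ.1 X),
    (measurable_of_countable fun d : Fin n → Bool =>
      if (numDisc d : ℝ) ≤ L then d else fun _ => false).comp φ.2⟩

/-- With at most `(K + 1) s` discoveries, the false discovery proportion is at least `N_FP / ((K +
1) s)`. With more, at most `s` of them are true, so the proportion is at least `K / (K + 1)`, which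
is exactly the scaled loss of rejecting nothing. -/
lemma truncate_loss_le {n s : ℕ} (hs : 1 ≤ s) {K : ℝ} (hK : 0 < K) (θ : Fin n → ℝ)
    (hθ : numNonzero θ = s) (φ : Procedure n) (X : Fin n → ℝ) :
    K / (K + 1) / s * (numFN θ ((φ.truncate ((K + 1) * s)).1 X)
        + 1 / (K + 1) * numFP θ ((φ.truncate ((K + 1) * s)).1 X))
      ≤ (numFP θ (φ.1 X) : ℝ) / max 1 (numDisc (φ.1 X) : ℝ)
        + (numFN θ (φ.1 X) : ℝ) / max 1 (numNonzero θ : ℝ) := by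
  have hs1 : (1 : ℝ) ≤ s := by exact_mod_cast hs
  have hs0 : (0 : ℝ) < s := by linarith
  rw [hθ, max_eq_right hs1]
  have hKK : K / (K + 1) ≤ 1 := div_le_one_of_le₀ (by linarith) (by linarith)
  set d := φ.1 X with hd
  have hdt : (φ.truncate ((K + 1) * s)).1 X
      = if (numDisc d : ℝ) ≤ (K + 1) * s then d else fun _ => false := rfl
  rw [hdt]
  split_ifs with h
  · have h1 : (numFP θ d : ℝ) / ((K + 1) * s) ≤ numFP θ d / max 1 (numDisc d : ℝ) := by
      refine div_le_div_of_nonneg_left (by positivity) (by positivity) (max_le ?_ h)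
      nlinarith
    calc K / (K + 1) / s * (numFN θ d + 1 / (K + 1) * numFP θ d)
        ≤ 1 / s * (numFN θ d + 1 / (K + 1) * numFP θ d) := by gcongr
      _ = numFP θ d / ((K + 1) * s) + numFN θ d / s := by field_simp; ring
      _ ≤ _ := by linarith
  · rw [numFP_false, numFN_false, hθ]
    have hD : (K + 1) * s < numDisc d := not_le.1 h
    have hle : (numDisc d : ℝ) ≤ numFP θ d + s := by
      have := numDisc_le_numFP_add θ d
      rw [hθ] at this
      exact_mod_cast this
    have hD1 : max 1 (numDisc d : ℝ) = numDisc d := max_eq_right (by nlinarith)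
    have hD0 : (0 : ℝ) < numDisc d := by nlinarith
    have h1 : K / (K + 1) ≤ numFP θ d / numDisc d := by
      rw [div_le_div_iff₀ (by linarith) hD0]
      nlinarith
    have h2 : 0 ≤ (numFN θ d : ℝ) / s := by positivity
    have h3 : K / (K + 1) / s * ((s : ℝ) + 1 / (K + 1) * ((0 : ℕ) : ℝ)) = K / (K + 1) := by
      field_simp
      simp
    rw [h3, hD1]
    linarith

lemma weightedRisk_truncate_le {n s : ℕ} (hs : 1 ≤ s) {K : ℝ} (hK : 0 < K) (θ : Fin n → ℝ)
    (hθ : numNonzero θ = s) (φ : Procedure n) :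
    K / (K + 1) / s * weightedRisk (1 / (K + 1)) θ (φ.truncate ((K + 1) * s))
      ≤ testingRisk θ φ := by
  set ψ := φ.truncate ((K + 1) * s)
  have i1 := ψ.integrable (fun d => (numFN θ d : ℝ)) (sequenceLaw θ)
  have i2 := ψ.integrable (fun d => 1 / (K + 1) * (numFP θ d : ℝ)) (sequenceLaw θ)
  have i3 := φ.integrable (fun d => (numFP θ d : ℝ) / max 1 (numDisc d : ℝ)) (sequenceLaw θ)
  have i4 := φ.integrable (fun d => (numFN θ d : ℝ) / max 1 (numNonzero θ : ℝ)) (sequenceLaw θ)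
  rw [weightedRisk, testingRisk, FDR, FNR, ← integral_const_mul, ← integral_add i1 i2,
    ← integral_const_mul, ← integral_add i3 i4]
  exact integral_mono ((i1.add i2).const_mul _) (i3.add i4) (truncate_loss_le hs hK θ hθ φ)

lemma le_minimaxTesting {n s : ℕ} (hs : 1 ≤ s) (hsn : s ≤ n) {b : EReal} {b' δ K : ℝ}
    (hK : 0 < K) (hb : b ≤ b') (hb' : 0 < √(2 * Real.log ((n : ℝ) / s)) + b')
    (hu : 2 * (s / (1 / (K + 1))) ≤
      (n - s) * gaussianTail ((√(2 * Real.log ((n : ℝ) / s)) - δ : ℝ) : EReal)) :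
    gaussianTail ((b' + δ : ℝ) : EReal) - 1 / (K + 1) - 2 / s ≤ minimaxTesting n s b := by
  have hs0 : (0 : ℝ) < s := by exact_mod_cast hs
  refine le_minimaxRisk testingRisk_le_two fun φ r hr => ?_
  have hc : 0 < K / (K + 1) / s := by positivity
  have h := le_of_weightedRisk_le hs hsn hb' (by positivity) hu (φ.truncate ((K + 1) * s))
    (r := r / (K / (K + 1) / s)) fun θ h1 h2 => by
      rw [le_div_iff₀ hc, mul_comm]
      exact (weightedRisk_truncate_le hs hK θ h1 φ).trans
        (hr θ (mem_signalClass_of_eq hb h1 h2))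
  have e : √(2 * Real.log ((n : ℝ) / s)) + b' - (√(2 * Real.log ((n : ℝ) / s)) - δ) = b' + δ := by
    ring
  rw [e, le_div_iff₀ hc] at h
  refine le_trans ?_ h
  set g := gaussianTail ((b' + δ : ℝ) : EReal)
  have hg1 : g ≤ 1 := gaussianTail_le_one _
  have hw1 : 1 / (K + 1) ≤ 1 := div_le_one_of_le₀ (by linarith) (by linarith)
  have hcw : K / (K + 1) = 1 - 1 / (K + 1) := by field_simp; ring
  have e2 : (s * g - 2 * (1 / (K + 1))) * (K / (K + 1) / s)
      = g * (K / (K + 1)) - 1 / (K + 1) * (K / (K + 1)) * (2 / s) := by field_simp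
  rw [e2, hcw]
  set w := 1 / (K + 1)
  have hw0 : 0 ≤ w := by positivity
  have h2s : 0 ≤ 2 / (s : ℝ) := by positivity
  have hww : w * (1 - w) ≤ 1 := by nlinarith
  -- With `K / (K + 1) = 1 - w`, the claim is `g (1 - w) - w (1 - w) (2 / s) ≥ g - w - 2 / s`.
  nlinarith [mul_le_mul_of_nonneg_right hww h2s, mul_le_mul_of_nonneg_right hg1 hw0]

/-! ### Asymptotics -/

lemma tendsto_sqrt_two_log {u : ℕ → ℝ} (hu : Tendsto u atTop atTop) :
    Tendsto (fun n => √(2 * Real.log (u n))) atTop atTop :=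
  Real.tendsto_sqrt_atTop.comp ((Real.tendsto_log_atTop.comp hu).const_mul_atTop two_pos)

lemma eventually_sparsity {s : ℕ → ℕ} (hs : Tendsto s atTop atTop)
    (hns : Tendsto (fun n : ℕ => (n : ℝ) / (s n : ℝ)) atTop atTop) :
    ∀ᶠ n in atTop, 1 ≤ s n ∧ 2 * s n ≤ n := by
  filter_upwards [hs.eventually_ge_atTop 1, hns.eventually_ge_atTop 2] with n h1 h2
  refine ⟨h1, ?_⟩
  rw [le_div_iff₀ (by exact_mod_cast h1)] at h2
  exact_mod_cast h2

/-- Many null observations exceed a level slightly below the universal threshold. -/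
lemma eventually_mul_le_gaussianTail {s : ℕ → ℕ} (hs : Tendsto s atTop atTop)
    (hns : Tendsto (fun n : ℕ => (n : ℝ) / (s n : ℝ)) atTop atTop) {δ : ℝ} (hδ : 0 < δ) (C : ℝ) :
    ∀ᶠ n : ℕ in atTop, C * s n ≤
      (n - s n) * gaussianTail ((√(2 * Real.log ((n : ℝ) / s n)) - δ : ℝ) : EReal) := by
  have ht := tendsto_sqrt_two_log hns
  -- Here `δ / 12` is `1/2 · (δ/2)/3`, from `n - s ≥ n/2` and `le_gaussianTail` with increment `δ /
  -- 2`; the exponent is what `-(t - δ/2)²/2` adds to `-t²/2`.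
  have hlim : Tendsto (fun n : ℕ => δ / 12 *
      Real.exp (√(2 * Real.log ((n : ℝ) / s n)) * (δ / 2) + -(δ ^ 2 / 8))) atTop atTop :=
    (Real.tendsto_exp_atTop.comp
      (tendsto_atTop_add_const_right _ _ (ht.atTop_mul_const (half_pos hδ)))).const_mul_atTop
      (by positivity)
  filter_upwards [eventually_sparsity hs hns, ht.eventually_ge_atTop δ,
    hlim.eventually_ge_atTop C] with n ⟨h1, h2⟩ h3 h4
  have hs0 : (0 : ℝ) < s n := by exact_mod_cast h1
  have hn2 : 2 * (s n : ℝ) ≤ n := by exact_mod_cast h2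
  have hu1 : 1 ≤ (n : ℝ) / s n := (one_le_div hs0).2 (by linarith)
  set t := √(2 * Real.log ((n : ℝ) / s n)) with ht
  have ht2 : t ^ 2 = 2 * Real.log ((n : ℝ) / s n) :=
    Real.sq_sqrt (by have := Real.log_nonneg hu1; positivity)
  have hexp : Real.exp (-t ^ 2 / 2) = s n / n := by
    have : -t ^ 2 / 2 = -Real.log ((n : ℝ) / s n) := by rw [neg_div, ht2]; ring
    rw [this, Real.exp_neg, Real.exp_log (by linarith), inv_div]
  have hn0 : (0 : ℝ) < n := by linarith
  have hG := le_gaussianTail (t - δ) (δ / 2) (by linarith) (by linarith)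
  have e : -(t - δ + δ / 2) ^ 2 / 2 = -t ^ 2 / 2 + (t * (δ / 2) + -(δ ^ 2 / 8)) := by ring
  rw [e, Real.exp_add, hexp] at hG
  calc C * s n ≤ δ / 12 * Real.exp (t * (δ / 2) + -(δ ^ 2 / 8)) * s n := by gcongr
    _ = n / 2 * (δ / 2 / 3 * (s n / n * Real.exp (t * (δ / 2) + -(δ ^ 2 / 8)))) := by
        field_simp
        norm_num
    _ ≤ (n - s n) * gaussianTail ((t - δ : ℝ) : EReal) :=
        mul_le_mul (by linarith) hG (by positivity) (by linarith)

lemma exists_gaussianTail_ge {ε : ℝ} (hε : 0 < ε) :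
    ∃ M : ℝ, 1 - ε ≤ gaussianTail ((-M : ℝ) : EReal) := by
  exact ((tendsto_gaussianTail_atBot.comp tendsto_neg_atTop_atBot).eventually_const_le
    (show 1 - ε < 1 by linarith)).exists

/-- The witness is `max b (-M)`. Clipping costs at most `ε` in the tail and keeps the spike height
`t + b'` positive once `t > M`, uniformly in `b`, including `b = ⊥`. -/
lemma exists_coe_ge (M : ℝ) {b : EReal} (hb : b ≠ ⊤) {ε : ℝ} (hε : 0 ≤ ε)
    (hM : 1 - ε ≤ gaussianTail ((-M : ℝ) : EReal)) :
    ∃ b' : ℝ, b ≤ b' ∧ -M ≤ b' ∧ gaussianTail b - ε ≤ gaussianTail (b' : EReal) := by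
  by_cases h : b ≤ ((-M : ℝ) : EReal)
  · exact ⟨-M, h, le_rfl, by linarith [gaussianTail_le_one b]⟩
  · rw [not_le] at h
    lift b to ℝ using ⟨hb, (bot_le.trans_lt h).ne'⟩
    exact ⟨b, le_rfl, by exact_mod_cast h.le, by linarith⟩

lemma eventually_div_le {s : ℕ → ℕ} (hs : Tendsto s atTop atTop) (c : ℝ) {ε : ℝ}
    (hε : 0 < ε) : ∀ᶠ n in atTop, c / s n ≤ ε :=
  ((tendsto_const_nhds (x := c)).div_atTop
    (tendsto_natCast_atTop_atTop.comp hs)).eventually_le_const hε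

lemma eventually_exp_le {s : ℕ → ℕ}
    (hns : Tendsto (fun n : ℕ => (n : ℝ) / (s n : ℝ)) atTop atTop) {δ : ℝ} (hδ : 0 < δ) (C : ℝ)
    {ε : ℝ} (hε : 0 < ε) :
    ∀ᶠ n : ℕ in atTop, C * Real.exp (-(√(2 * Real.log ((n : ℝ) / s n)) * δ)) ≤ ε := by
  have h := (Real.tendsto_exp_neg_atTop_nhds_zero.comp
    ((tendsto_sqrt_two_log hns).atTop_mul_const hδ)).const_mul C
  rw [mul_zero] at h
  exact h.eventually_le_const hε

lemma gaussianTail_sub_le_add (b δ : ℝ) (hδ : 0 ≤ δ) :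
    gaussianTail ((b - δ : ℝ) : EReal) ≤ gaussianTail (b : EReal) + δ := by
  have := gaussianTail_sub_le (b - δ) δ hδ
  rw [sub_add_cancel] at this
  linarith

lemma eventually_minimaxClassification_le {s : ℕ → ℕ} (hs : Tendsto s atTop atTop)
    (hns : Tendsto (fun n : ℕ => (n : ℝ) / (s n : ℝ)) atTop atTop) {ε : ℝ} (hε : 0 < ε) :
    ∀ᶠ n in atTop, ∀ b : EReal, minimaxClassification n (s n) b ≤ gaussianTail b + ε := by
  filter_upwards [eventually_sparsity hs hns, eventually_exp_le hns (half_pos hε) 2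
    (half_pos hε)] with n ⟨h1, h2⟩ h3 b
  induction b with
  | bot => linarith [minimaxClassification_le_one n (s n) ⊥, gaussianTail_bot]
  | top => linarith [minimaxClassification_top (n := n) h1, gaussianTail_top]
  | coe b =>
    have := minimaxClassification_le (n := n) h1 (by omega) b (half_pos hε).le
    linarith [gaussianTail_sub_le_add b (ε / 2) (half_pos hε).le]

lemma eventually_minimaxTesting_le {s : ℕ → ℕ} (hs : Tendsto s atTop atTop)
    (hns : Tendsto (fun n : ℕ => (n : ℝ) / (s n : ℝ)) atTop atTop) {ε : ℝ} (hε : 0 < ε) :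
    ∀ᶠ n in atTop, ∀ b : EReal, minimaxTesting n (s n) b ≤ gaussianTail b + ε := by
  obtain ⟨M, hM⟩ := exists_gaussianTail_ge hε
  have hε3 : 0 < ε / 3 := by linarith
  -- This is a lower bound for the detection probability valid for all `b > -M`; it depends on `ε`
  -- only, so the errors are uniform in `b`.
  set p := gaussianTail ((M + ε / 3 : ℝ) : EReal) with hp
  have hp0 : 0 < p := gaussianTail_pos _
  filter_upwards [eventually_sparsity hs hns, eventually_exp_le hns hε3 (4 / p) hε3,
    eventually_div_le hs (4 / p) hε3] with n ⟨h1, h2⟩ h3 h4 b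
  by_cases hb : b ≤ ((-M : ℝ) : EReal)
  · linarith [minimaxTesting_le_one n (s n) b, gaussianTail_antitone hb]
  rw [not_le] at hb
  induction b with
  | bot => exact absurd hb not_lt_bot
  | top => linarith [minimaxTesting_top (n := n) h1, gaussianTail_top]
  | coe b =>
    have hMb : -M < b := by exact_mod_cast hb
    have hpb : gaussianTail ((b - ε / 3 : ℝ) : EReal) ≤ 1 - p := by
      rw [hp, ← gaussianTail_neg]
      exact gaussianTail_antitone (EReal.coe_le_coe_iff.2 (by linarith))
    have h := minimaxTesting_le (n := n) h1 (by omega) b hε3.le hp0 hpb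
    rw [div_div, mul_comm p] at h4
    linarith [gaussianTail_sub_le_add b (ε / 3) hε3.le]

lemma eventually_le_minimaxClassification {s : ℕ → ℕ} (hs : Tendsto s atTop atTop)
    (hns : Tendsto (fun n : ℕ => (n : ℝ) / (s n : ℝ)) atTop atTop) {ε : ℝ} (hε : 0 < ε) :
    ∀ᶠ n in atTop, ∀ b : EReal, gaussianTail b - ε ≤ minimaxClassification n (s n) b := by
  have hε3 : 0 < ε / 3 := by linarith
  obtain ⟨M, hM⟩ := exists_gaussianTail_ge hε3
  filter_upwards [eventually_sparsity hs hns, eventually_mul_le_gaussianTail hs hns hε3 2,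
    eventually_div_le hs 2 hε3, (tendsto_sqrt_two_log hns).eventually_gt_atTop M]
    with n ⟨h1, h2⟩ h3 h4 h5 b
  by_cases hb : b = ⊤
  · rw [hb, gaussianTail_top]
    linarith [minimaxClassification_nonneg n (s n) ⊤]
  obtain ⟨b', hb1, hb2, hb3⟩ := exists_coe_ge M hb hε3.le hM
  have h := le_minimaxClassification (n := n) (δ := ε / 3) h1 (by omega) hb1 (by linarith) (by rwa [div_one])
  linarith [gaussianTail_sub_le b' (ε / 3) hε3.le]

lemma eventually_le_minimaxTesting {s : ℕ → ℕ} (hs : Tendsto s atTop atTop)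
    (hns : Tendsto (fun n : ℕ => (n : ℝ) / (s n : ℝ)) atTop atTop) {ε : ℝ} (hε : 0 < ε) :
    ∀ᶠ n in atTop, ∀ b : EReal, gaussianTail b - ε ≤ minimaxTesting n (s n) b := by
  have hε4 : 0 < ε / 4 := by linarith
  obtain ⟨M, hM⟩ := exists_gaussianTail_ge hε4
  -- `K = 4 / ε` makes the truncation loss at most `ε / 4`; clipping, the shift by `δ` and the
  -- Chebyshev term `2 / s` take the other three quarters.
  have hK : 0 < 4 / ε := by positivity
  have hw : 1 / (4 / ε + 1) ≤ ε / 4 := by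
    rw [div_le_iff₀ (by positivity), mul_add, div_mul_div_cancel₀ (by norm_num), div_self hε.ne']
    linarith
  filter_upwards [eventually_sparsity hs hns,
    eventually_mul_le_gaussianTail hs hns hε4 (2 * (4 / ε + 1)),
    eventually_div_le hs 2 hε4, (tendsto_sqrt_two_log hns).eventually_gt_atTop M]
    with n ⟨h1, h2⟩ h3 h4 h5 b
  by_cases hb : b = ⊤
  · rw [hb, gaussianTail_top]
    linarith [minimaxTesting_nonneg n (s n) ⊤]
  obtain ⟨b', hb1, hb2, hb3⟩ := exists_coe_ge M hb hε4.le hM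
  have h := le_minimaxTesting (n := n) (δ := ε / 4) h1 (by omega) hK hb1 (by linarith)
    (by rw [div_div_eq_mul_div, div_one]; linarith)
  linarith [gaussianTail_sub_le b' (ε / 4) hε4.le]

/-- A risk that is uniformly close to the Gaussian tail has the corresponding limits. -/
lemma limits_of_uniform {ρ : ℕ → EReal → ℝ}
    (hle : ∀ ε : ℝ, 0 < ε → ∀ᶠ n in atTop, ∀ b, ρ n b ≤ gaussianTail b + ε)
    (hge : ∀ ε : ℝ, 0 < ε → ∀ᶠ n in atTop, ∀ b, gaussianTail b - ε ≤ ρ n b) :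
    (∀ b : ℕ → EReal, Tendsto (fun n => ρ n (b n) - gaussianTail (b n)) atTop (𝓝 0)) ∧
    (∀ b : ℕ → ℝ, Tendsto b atTop atBot → Tendsto (fun n => ρ n (b n)) atTop (𝓝 1)) ∧
    (∀ b : ℝ, Tendsto (fun n => ρ n b) atTop (𝓝 (gaussianTail b))) ∧
    (∀ b : ℕ → ℝ, Tendsto b atTop atTop → Tendsto (fun n => ρ n (b n)) atTop (𝓝 0)) := by
  have h : ∀ b : ℕ → EReal,
      Tendsto (fun n => ρ n (b n) - gaussianTail (b n)) atTop (𝓝 0) := by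
    intro b
    rw [Metric.tendsto_nhds]
    intro ε hε
    filter_upwards [hle _ (half_pos hε), hge _ (half_pos hε)] with n h1 h2
    rw [Real.dist_0_eq_abs, abs_lt]
    constructor <;> linarith [h1 (b n), h2 (b n)]
  have h' : ∀ (b : ℕ → ℝ) (l : ℝ), Tendsto (fun n => gaussianTail (b n : EReal)) atTop (𝓝 l) →
      Tendsto (fun n => ρ n (b n)) atTop (𝓝 l) := by
    intro b l hl
    simpa using (h fun n => (b n : EReal)).add hl
  exact ⟨h, fun b hb => h' b 1 (tendsto_gaussianTail_atBot.comp hb),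
    fun b => h' (fun _ => b) _ tendsto_const_nhds,
    fun b hb => h' b 0 (tendsto_gaussianTail_atTop.comp hb)⟩

end SparseTesting

theorem mainTheorem11 (s : ℕ → ℕ)
    (hs : Tendsto s atTop atTop)
    (hns : Tendsto (fun n : ℕ => (n : ℝ) / (s n : ℝ)) atTop atTop) :
    -- multiple testing risk
    ((∀ b : ℕ → EReal, Tendsto (fun n =>
          SparseTesting.minimaxTesting n (s n) (b n) - SparseTesting.gaussianTail (b n))
        atTop (𝓝 0)) ∧
      (∀ b : ℕ → ℝ, Tendsto b atTop atBot →
        Tendsto (fun n => SparseTesting.minimaxTesting n (s n) (b n)) atTop (𝓝 1)) ∧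
      (∀ b : ℝ, Tendsto (fun n => SparseTesting.minimaxTesting n (s n) b)
        atTop (𝓝 (SparseTesting.gaussianTail b))) ∧
      (∀ b : ℕ → ℝ, Tendsto b atTop atTop →
        Tendsto (fun n => SparseTesting.minimaxTesting n (s n) (b n)) atTop (𝓝 0))) ∧
    -- normalised classification risk
    ((∀ b : ℕ → EReal, Tendsto (fun n =>
          SparseTesting.minimaxClassification n (s n) (b n) - SparseTesting.gaussianTail (b n))
        atTop (𝓝 0)) ∧
      (∀ b : ℕ → ℝ, Tendsto b atTop atBot →
        Tendsto (fun n => SparseTesting.minimaxClassification n (s n) (b n)) atTop (𝓝 1)) ∧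
      (∀ b : ℝ, Tendsto (fun n => SparseTesting.minimaxClassification n (s n) b)
        atTop (𝓝 (SparseTesting.gaussianTail b))) ∧
      (∀ b : ℕ → ℝ, Tendsto b atTop atTop →
        Tendsto (fun n => SparseTesting.minimaxClassification n (s n) (b n)) atTop (𝓝 0))) :=
  ⟨SparseTesting.limits_of_uniform
    (fun _ hε => SparseTesting.eventually_minimaxTesting_le hs hns hε)
    (fun _ hε => SparseTesting.eventually_le_minimaxTesting hs hns hε),
  SparseTesting.limits_of_uniform
    (fun _ hε => SparseTesting.eventually_minimaxClassification_le hs hns hε)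
    (fun _ hε => SparseTesting.eventually_le_minimaxClassification hs hns hε)⟩
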